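/- Let $\Gamma$ be an invertible constant complex $n\times n$ matrix such that $\Gamma$ and $-\Gamma^\dagger$ have no eigenvalue in common ($\dagger$ denotes the conjugate transpose, ${}^*$ complex conjugation). Let $D\subseteq\mathbb{R}^2$ be open (for instance $D=\mathbb{R}^2$) and let $u: D\to\mathbb{C}$ be a smooth solution of the Fokas--Lenells equation $$u_{xt}-u-2\mathrm{i}\,|u|^2u_x=0 .$$ Let $\eta_1,\tilde\eta_2: D\to\mathbb{C}^n$ be smooth column vector solutions of the linear system $$\Gamma\,\eta_{1x}+\tfrac12\eta_1-u_x\,\tilde\eta_2=0,\qquad \eta_{1t}-\big(\mathrm{i}|u|^2I-\tfrac12\Gamma\big)\eta_1-u\,\tilde\eta_2=0,$$ $$\Gamma\,\tilde\eta_{2x}-\tfrac12\tilde\eta_2+\mathrm{i}\,u_x^*\,\Gamma\eta_1=0,\qquad \tilde\eta_{2t}+\big(\mathrm{i}|u|^2I-\tfrac12\Gamma\big)\tilde\eta_2-\mathrm{i}\,u^*\,\Gamma\eta_1=0,$$ and let $\Omega$ be an $n\times n$ matrix-valued function on $D$ solving the Lyapunov equation $$\Gamma\Omega+\Omega\Gamma^\dagger=\mathrm{i}\,\eta_1\eta_1^\dagger\Gamma^\dagger+\tilde\eta_2\tilde\eta_2^\dagger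 .$$ Then, on any open set $U\subseteq D$ on which $\Omega$ is invertible, the function $$u'=u-\tilde\eta_2^\dagger\,\Omega^{-1}\eta_1$$ is smooth and solves the Fokas--Lenells equation. -/

import Mathlib

open scoped ContDiff Matrix

/-- Partial derivative with respect to the first variable `x` at the point `p = (x, t)`. -/
noncomputable def partialX {E : Type*} [NormedAddCommGroup E] [NormedSpace ℝ E]
    (f : ℝ × ℝ → E) (p : ℝ × ℝ) : E :=
  deriv (fun s : ℝ => f (s, p.2)) p.1

/-- Partial derivative with respect to the second variable `t` at the point `p = (x, t)`. -/
noncomputable def partialT {E : Type*} [NormedAddCommGroup E] [NormedSpace ℝ E]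
    (f : ℝ × ℝ → E) (p : ℝ × ℝ) : E :=
  deriv (fun s : ℝ => f (p.1, s)) p.2

/-- `u` is a smooth solution on the (open) set `D` of the Fokas-Lenells equation
`u_xt - u - 2 i |u|² u_x = 0`. -/
def IsFokasLenellsSolutionOn (D : Set (ℝ × ℝ)) (u : ℝ × ℝ → ℂ) : Prop :=
  ContDiffOn ℝ ∞ u D ∧
    ∀ p ∈ D, partialT (partialX u) p - u p
      - 2 * Complex.I * ((‖u p‖ : ℂ) ^ 2) * partialX u p = 0

/-- `η₁, η₂` are smooth column vectors on the (open) set `D` that solve the linear system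
associated with the matrix `Γ` and the function `u`. -/
structure IsLinearSystemSolutionOn {n : ℕ} (D : Set (ℝ × ℝ)) (Γ : Matrix (Fin n) (Fin n) ℂ)
    (u : ℝ × ℝ → ℂ) (η₁ η₂ : ℝ × ℝ → Fin n → ℂ) : Prop where
  smooth₁ : ContDiffOn ℝ ∞ η₁ D
  smooth₂ : ContDiffOn ℝ ∞ η₂ D
  eq_x₁ : ∀ p ∈ D,
    Γ *ᵥ partialX η₁ p + (1 / 2 : ℂ) • η₁ p - partialX u p • η₂ p = 0
  eq_t₁ : ∀ p ∈ D,
    partialT η₁ p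
      - ((Complex.I * (‖u p‖ : ℂ) ^ 2) • (1 : Matrix (Fin n) (Fin n) ℂ) - (1 / 2 : ℂ) • Γ) *ᵥ η₁ p
      - u p • η₂ p = 0
  eq_x₂ : ∀ p ∈ D,
    Γ *ᵥ partialX η₂ p - (1 / 2 : ℂ) • η₂ p
      + (Complex.I * star (partialX u p)) • (Γ *ᵥ η₁ p) = 0
  eq_t₂ : ∀ p ∈ D,
    partialT η₂ p
      + ((Complex.I * (‖u p‖ : ℂ) ^ 2) • (1 : Matrix (Fin n) (Fin n) ℂ) - (1 / 2 : ℂ) • Γ) *ᵥ η₂ p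
      - (Complex.I * star (u p)) • (Γ *ᵥ η₁ p) = 0

/-- The function `u' = u - η₂† Ω⁻¹ η₁`. -/
noncomputable def darbouxTransform {n : ℕ} (u : ℝ × ℝ → ℂ) (η₁ η₂ : ℝ × ℝ → Fin n → ℂ)
    (Ω : ℝ × ℝ → Matrix (Fin n) (Fin n) ℂ) (p : ℝ × ℝ) : ℂ :=
  u p - star (η₂ p) ⬝ᵥ ((Ω p)⁻¹ *ᵥ η₁ p)

/-!
Since `Γ` and `-Γ†` have disjoint spectra, the Sylvester operator `M ↦ Γ M + M Γ†` is injective. So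
`Ω` is as smooth as the right-hand side of the Lyapunov equation, its derivatives `Ω_x`, `Ω_t` are
found by guessing solutions of the differentiated equation, and `Ω† = Ω - i η₁ η₁†`. The last
identity makes `P = 1 - i η₁† Ω⁻¹ η₁` unimodular, and a computation gives `u'_x = P W` with
`W = u_x (1 - η₂† Ω⁻¹ Γ⁻¹ η₂) + η₂† Ω⁻¹ Γ⁻¹ η₁`. Both factors satisfy scalar linear equations,
`P_t = i (|u'|² - |u|²) P` and `W_t = P* u' + i (|u|² + |u'|²) W`, whence
`(P W)_t = u' + 2 i |u'|² P W` because `P P* = 1`.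
-/

open Complex (I)
open Filter Topology

section Sylvester

/-- The operator `M ↦ A M + M B` of the Sylvester equation `A M + M B = C`, as a continuous linear
map, so that its injectivity transfers smoothness from the right-hand side to the solution. -/
noncomputable def sylvesterCLM (𝕜 : Type*) {R : Type*} [NontriviallyNormedField 𝕜] [NormedRing R]
    [NormedAlgebra 𝕜 R] (A B : R) : R →L[𝕜] R :=
  ContinuousLinearMap.mul 𝕜 R A + (ContinuousLinearMap.mul 𝕜 R).flip B

theorem sylvesterCLM_apply {𝕜 R : Type*} [NontriviallyNormedField 𝕜] [NormedRing R]
    [NormedAlgebra 𝕜 R] (A B M : R) : sylvesterCLM 𝕜 A B M = A * M + M * B :=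
  rfl

theorem semiconjBy_aeval {R S : Type*} [CommSemiring R] [Semiring S] [Algebra R S] {M A B : S}
    (h : SemiconjBy M B A) (p : Polynomial R) :
    SemiconjBy M (Polynomial.aeval B p) (Polynomial.aeval A p) := by
  induction p using Polynomial.induction_on' with
  | add p q hp hq => simpa only [map_add] using hp.add_right hq
  | monomial k c =>
    simpa only [Polynomial.aeval_monomial] using
      SemiconjBy.mul_right (Algebra.commute_algebraMap_right c M) (h.pow_right k)

variable {ι : Type*} [Fintype ι] [DecidableEq ι]

theorem isUnit_aeval_charpoly {K R : Type*} [Field K] [IsAlgClosed K] [Ring R] [Algebra K R]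
    {A : R} {B : Matrix ι ι K} (h : Disjoint (spectrum K A) (spectrum K B)) :
    IsUnit (Polynomial.aeval A B.charpoly) := by
  by_contra hA
  rw [(IsAlgClosed.splits B.charpoly).eq_prod_roots_of_monic B.charpoly_monic] at hA
  obtain ⟨μ, hμA, hμB⟩ := spectrum.exists_mem_of_not_isUnit_aeval_prod hA
  exact Set.disjoint_left.1 h hμA (Matrix.mem_spectrum_iff_isRoot_charpoly.2 hμB)

theorem eq_zero_of_semiconjBy {K : Type*} [Field K] [IsAlgClosed K] {A B M : Matrix ι ι K}
    (h : Disjoint (spectrum K A) (spectrum K B)) (hM : SemiconjBy M B A) : M = 0 := by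
  have key : M * Polynomial.aeval B B.charpoly = Polynomial.aeval A B.charpoly * M :=
    semiconjBy_aeval hM B.charpoly
  rw [Matrix.aeval_self_charpoly, mul_zero] at key
  exact (isUnit_aeval_charpoly h).mul_right_eq_zero.1 key.symm

open scoped Matrix.Norms.Operator in
theorem injective_sylvesterCLM {𝕜 K : Type*} [NontriviallyNormedField 𝕜] [NormedField K]
    [IsAlgClosed K] [NormedAlgebra 𝕜 K] {A B : Matrix ι ι K}
    (h : Disjoint (spectrum K A) (spectrum K (-B))) :
    Function.Injective (sylvesterCLM 𝕜 A B) := by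
  refine (injective_iff_map_eq_zero _).2 fun M hM => eq_zero_of_semiconjBy h ?_
  rw [SemiconjBy, mul_neg, ← sub_eq_zero, ← neg_eq_zero, neg_sub, sub_neg_eq_add]
  exact hM

end Sylvester

section LeftInverse

variable {𝕜 E F G : Type*} [NontriviallyNormedField 𝕜] [NormedAddCommGroup E] [NormedSpace 𝕜 E]
  [NormedAddCommGroup F] [NormedSpace 𝕜 F] [NormedAddCommGroup G] [NormedSpace 𝕜 G]
  {L : E →L[𝕜] F}

theorem hasDerivAt_of_comp_hasLeftInverse (hL : L.HasLeftInverse) {f : 𝕜 → E} {f' : E} {t : 𝕜}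
    (h : HasDerivAt (fun s => L (f s)) (L f') t) : HasDerivAt f f' t := by
  obtain ⟨T, hT⟩ := hL
  simpa only [Function.comp_def, hT _] using T.hasFDerivAt.comp_hasDerivAt t h

theorem contDiffOn_of_comp_hasLeftInverse (hL : L.HasLeftInverse) {f : G → E} {s : Set G}
    {k : WithTop ℕ∞} (h : ContDiffOn 𝕜 k (fun p => L (f p)) s) : ContDiffOn 𝕜 k f s := by
  obtain ⟨T, hT⟩ := hL
  simpa only [Function.comp_def, hT _] using T.contDiff.comp_contDiffOn h

end LeftInverse

section SesquilinearForm

variable {ι R : Type*} [Fintype ι] [DecidableEq ι] [CommRing R] [StarRing R]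

/-- The sesquilinear form `(x, y) ↦ x† W y` of a matrix `W`, conjugate-linear in `x`; the Darboux
transformation is expressed through the forms of `W = Ω⁻¹`. -/
noncomputable def sesqForm : Matrix ι ι R ≃ₗ[R] (ι → R) →ₗ⋆[R] (ι → R) →ₗ[R] R :=
  Matrix.toLinearMapₛₗ₂' R (starRingEnd R) (RingHom.id R)

theorem sesqForm_apply (W : Matrix ι ι R) (x y : ι → R) :
    sesqForm W x y = star x ⬝ᵥ (W *ᵥ y) := by
  simp only [sesqForm, Matrix.toLinearMapₛₗ₂'_apply, dotProduct, Matrix.mulVec, Finset.mul_sum,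
    Pi.star_apply, starRingEnd_apply, RingHom.id_apply, smul_eq_mul, mul_comm (W _ _)]

theorem star_sesqForm (W : Matrix ι ι R) (x y : ι → R) :
    star (sesqForm W x y) = sesqForm Wᴴ y x := by
  rw [sesqForm_apply, sesqForm_apply, Matrix.dotProduct_mulVec (star y), ← Matrix.star_mulVec,
    ← Matrix.star_dotProduct]

theorem sesqForm_mul (W A : Matrix ι ι R) (x y : ι → R) :
    sesqForm (W * A) x y = sesqForm W x (A *ᵥ y) := by
  simp only [sesqForm_apply, Matrix.mulVec_mulVec]

theorem sesqForm_conjTranspose_mul (A W : Matrix ι ι R) (x y : ι → R) :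
    sesqForm (Aᴴ * W) x y = sesqForm W (A *ᵥ x) y := by
  simp only [sesqForm_apply, Matrix.star_mulVec, ← Matrix.mulVec_mulVec, Matrix.dotProduct_mulVec,
    Matrix.vecMul_vecMul]

theorem sesqForm_mul_vecMulVec_mul (V W : Matrix ι ι R) (c d x y : ι → R) :
    sesqForm (V * Matrix.vecMulVec c (star d) * W) x y = sesqForm V x c * sesqForm W d y := by
  simp only [sesqForm_apply, ← Matrix.mulVec_mulVec, Matrix.vecMulVec_mulVec,
    Matrix.mulVec_smul, dotProduct_smul, op_smul_eq_smul, smul_eq_mul, mul_comm]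

end SesquilinearForm

section MatrixCalculus

open scoped Matrix.Norms.Operator

variable {ι : Type*}

theorem hasDerivAt_matrix [Finite ι] {M : ℝ → Matrix ι ι ℂ} {M' : Matrix ι ι ℂ} {t : ℝ} :
    HasDerivAt M M' t ↔ ∀ i j, HasDerivAt (fun s => M s i j) (M' i j) t := by
  have := Fintype.ofFinite ι
  exact (hasDerivAt_pi (φ := fun s i j => M s i j) (φ' := M')).trans
    (forall_congr' fun _ => hasDerivAt_pi)

theorem hasDerivAt_vecMulVec [Finite ι] {x y : ℝ → ι → ℂ} {x' y' : ι → ℂ} {t : ℝ}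
    (hx : HasDerivAt x x' t) (hy : HasDerivAt y y' t) :
    HasDerivAt (fun s => Matrix.vecMulVec (x s) (y s))
      (Matrix.vecMulVec x' (y t) + Matrix.vecMulVec (x t) y') t := by
  have := Fintype.ofFinite ι
  exact hasDerivAt_matrix.2 fun i j => (hasDerivAt_pi.1 hx i).mul (hasDerivAt_pi.1 hy j)

variable [Fintype ι]

theorem hasDerivAt_mulVec {y : ℝ → ι → ℂ} {y' : ι → ℂ} {t : ℝ} (A : Matrix ι ι ℂ)
    (hy : HasDerivAt y y' t) : HasDerivAt (fun s => A *ᵥ y s) (A *ᵥ y') t :=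
  (A.mulVecLin.restrictScalars ℝ).toContinuousLinearMap.hasFDerivAt.comp_hasDerivAt t hy

variable {G : Type*} [NormedAddCommGroup G] [NormedSpace ℝ G] {s : Set G} {k : WithTop ℕ∞}

theorem contDiffOn_star {E : Type*} [NormedAddCommGroup E] [NormedSpace ℝ E] [StarAddMonoid E]
    [StarModule ℝ E] [ContinuousStar E] {x : G → E} (hx : ContDiffOn ℝ k x s) :
    ContDiffOn ℝ k (fun p => star (x p)) s :=
  (starL' ℝ : E ≃L[ℝ] E).contDiff.comp_contDiffOn hx

theorem contDiffOn_matrix {M : G → Matrix ι ι ℂ} :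
    ContDiffOn ℝ k M s ↔ ∀ i j, ContDiffOn ℝ k (fun p => M p i j) s := by
  rw [← (Matrix.ofLinearEquiv ℝ).symm.toContinuousLinearEquiv.comp_contDiffOn_iff,
    contDiffOn_pi]
  exact forall_congr' fun _ => contDiffOn_pi

theorem contDiffOn_vecMulVec {x y : G → ι → ℂ} (hx : ContDiffOn ℝ k x s)
    (hy : ContDiffOn ℝ k y s) : ContDiffOn ℝ k (fun p => Matrix.vecMulVec (x p) (y p)) s :=
  contDiffOn_matrix.2 fun i j => (contDiffOn_pi.1 hx i).mul (contDiffOn_pi.1 hy j)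

variable [DecidableEq ι]

theorem contDiffOn_matrix_inv {M : G → Matrix ι ι ℂ} (hM : ContDiffOn ℝ k M s)
    (hu : ∀ p ∈ s, IsUnit (M p)) : ContDiffOn ℝ k (fun p => (M p)⁻¹) s := by
  intro p hp
  obtain ⟨w, hw⟩ := hu p hp
  have h := contDiffAt_ringInverse ℝ (n := k) w
  rw [hw] at h
  simp only [Matrix.nonsing_inv_eq_ringInverse]
  exact h.comp_contDiffWithinAt p (hM p hp)

theorem contDiffOn_sesqForm {W : G → Matrix ι ι ℂ} {x y : G → ι → ℂ} (hW : ContDiffOn ℝ k W s)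
    (hx : ContDiffOn ℝ k x s) (hy : ContDiffOn ℝ k y s) :
    ContDiffOn ℝ k (fun p => sesqForm (W p) (x p) (y p)) s := by
  simp only [sesqForm_apply, dotProduct, Matrix.mulVec]
  exact ContDiffOn.sum fun i _ => (contDiffOn_pi.1 (contDiffOn_star hx) i).mul <|
    ContDiffOn.sum fun j _ => (contDiffOn_matrix.1 hW i j).mul (contDiffOn_pi.1 hy j)

theorem hasDerivAt_matrix_inv {M : ℝ → Matrix ι ι ℂ} {M' : Matrix ι ι ℂ} {t : ℝ}
    (hM : HasDerivAt M M' t) (hu : IsUnit (M t)) :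
    HasDerivAt (fun s => (M s)⁻¹) (-((M t)⁻¹ * M' * (M t)⁻¹)) t := by
  obtain ⟨w, hw⟩ := hu
  have h := hasFDerivAt_ringInverse (𝕜 := ℝ) w
  rw [hw] at h
  simp only [Matrix.nonsing_inv_eq_ringInverse]
  exact (h.comp_hasDerivAt t hM).congr_deriv (by simp [← hw])

theorem hasDerivAt_sesqForm {W : ℝ → Matrix ι ι ℂ} {W' : Matrix ι ι ℂ} {x y : ℝ → ι → ℂ}
    {x' y' : ι → ℂ} {t : ℝ} (hW : HasDerivAt W W' t) (hx : HasDerivAt x x' t)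
    (hy : HasDerivAt y y' t) :
    HasDerivAt (fun s => sesqForm (W s) (x s) (y s))
      (sesqForm W' (x t) (y t) + sesqForm (W t) x' (y t) + sesqForm (W t) (x t) y') t := by
  simp only [sesqForm_apply, dotProduct, Matrix.mulVec, Finset.mul_sum, ← Finset.sum_add_distrib]
  refine HasDerivAt.fun_sum fun i _ => HasDerivAt.fun_sum fun j _ => ?_
  refine ((hasDerivAt_pi.1 hx.star i).mul
    ((hasDerivAt_matrix.1 hW i j).mul (hasDerivAt_pi.1 hy j))).congr_deriv ?_
  simp only [Pi.star_apply, Pi.mul_apply]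
  ring

theorem hasDerivAt_sesqForm_inv {Ω : ℝ → Matrix ι ι ℂ} {Ω' : Matrix ι ι ℂ} {x y : ℝ → ι → ℂ}
    {x' y' : ι → ℂ} {t : ℝ} (hΩ : HasDerivAt Ω Ω' t) (hu : IsUnit (Ω t))
    (hx : HasDerivAt x x' t) (hy : HasDerivAt y y' t) :
    HasDerivAt (fun s => sesqForm (Ω s)⁻¹ (x s) (y s))
      (sesqForm (Ω t)⁻¹ x' (y t) + sesqForm (Ω t)⁻¹ (x t) y'
        - sesqForm ((Ω t)⁻¹ * Ω' * (Ω t)⁻¹) (x t) (y t)) t := by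
  refine (hasDerivAt_sesqForm (hasDerivAt_matrix_inv hΩ hu) hx hy).congr_deriv ?_
  simp only [map_neg, LinearMap.neg_apply]
  ring

end MatrixCalculus

/-- The Lyapunov equation for the matrix `Ω` at one point, with `a = η₁` and `b = η₂`. -/
def IsLyapunovSolution {ι : Type*} [Fintype ι] (Γ Ω : Matrix ι ι ℂ) (a b : ι → ℂ) : Prop :=
  Γ * Ω + Ω * Γᴴ = I • (Matrix.vecMulVec a (star a) * Γᴴ) + Matrix.vecMulVec b (star b)

section Lyapunov

open scoped Matrix.Norms.Operator

variable {ι : Type*} [Fintype ι] [DecidableEq ι] {Γ : Matrix ι ι ℂ}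

theorem conjTranspose_eq_of_lyapunov {Ω : Matrix ι ι ℂ} {a b : ι → ℂ}
    (hΓ : Disjoint (spectrum ℂ Γ) (spectrum ℂ (-Γᴴ)))
    (h : IsLyapunovSolution Γ Ω a b) :
    Ωᴴ = Ω - I • Matrix.vecMulVec a (star a) := by
  rw [IsLyapunovSolution] at h
  have hH := congrArg Matrix.conjTranspose h
  simp only [Matrix.conjTranspose_add, Matrix.conjTranspose_mul, Matrix.conjTranspose_smul,
    Matrix.conjTranspose_vecMulVec, Matrix.conjTranspose_conjTranspose, star_star,
    Complex.star_def, Complex.conj_I] at hH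
  refine injective_sylvesterCLM (𝕜 := ℂ) hΓ ?_
  rw [sylvesterCLM_apply, sylvesterCLM_apply, add_comm, hH, mul_sub, sub_mul, sub_add_sub_comm, h,
    mul_smul_comm, smul_mul_assoc]
  module

theorem hasDerivAt_of_lyapunov {Ω : ℝ → Matrix ι ι ℂ} {Ω' : Matrix ι ι ℂ} {a b : ℝ → ι → ℂ}
    {a' b' : ι → ℂ} {t : ℝ} (hΓ : Disjoint (spectrum ℂ Γ) (spectrum ℂ (-Γᴴ)))
    (ha : HasDerivAt a a' t) (hb : HasDerivAt b b' t)
    (h : ∀ᶠ s in 𝓝 t, IsLyapunovSolution Γ (Ω s) (a s) (b s))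
    (hΩ' : Γ * Ω' + Ω' * Γᴴ =
      I • ((Matrix.vecMulVec a' (star (a t)) + Matrix.vecMulVec (a t) (star a')) * Γᴴ)
        + (Matrix.vecMulVec b' (star (b t)) + Matrix.vecMulVec (b t) (star b'))) :
    HasDerivAt Ω Ω' t := by
  refine hasDerivAt_of_comp_hasLeftInverse (L := sylvesterCLM ℝ Γ Γᴴ)
    (.of_injective_of_finiteDimensional (injective_sylvesterCLM hΓ)) ?_
  rw [sylvesterCLM_apply, hΩ']
  exact ((((hasDerivAt_vecMulVec ha ha.star).mul_const Γᴴ).const_smul I).add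
    (hasDerivAt_vecMulVec hb hb.star)).congr_of_eventuallyEq h

theorem contDiffOn_of_lyapunov {G : Type*} [NormedAddCommGroup G] [NormedSpace ℝ G] {s : Set G}
    {k : WithTop ℕ∞} {Ω : G → Matrix ι ι ℂ} {a b : G → ι → ℂ}
    (hΓ : Disjoint (spectrum ℂ Γ) (spectrum ℂ (-Γᴴ)))
    (ha : ContDiffOn ℝ k a s) (hb : ContDiffOn ℝ k b s)
    (h : ∀ p ∈ s, IsLyapunovSolution Γ (Ω p) (a p) (b p)) :
    ContDiffOn ℝ k Ω s := by
  refine contDiffOn_of_comp_hasLeftInverse (L := sylvesterCLM ℝ Γ Γᴴ)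
    (.of_injective_of_finiteDimensional (injective_sylvesterCLM hΓ)) ?_
  exact ((((contDiffOn_vecMulVec ha (contDiffOn_star ha)).mul contDiffOn_const).const_smul I).add
    (contDiffOn_vecMulVec hb (contDiffOn_star hb))).congr h

end Lyapunov

/-- A Darboux potential `Ω` for `Γ` and the vectors `a = η₁`, `b = η₂` at one point: an invertible
solution of the Lyapunov equation, together with the formula for its adjoint that the equation
forces as soon as `Γ` and `-Γ†` have no common eigenvalue. -/
structure IsDarbouxPotential {ι : Type*} [Fintype ι] [DecidableEq ι] (Γ Ω : Matrix ι ι ℂ)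
    (a b : ι → ℂ) : Prop where
  isUnit : IsUnit Ω
  lyapunov : IsLyapunovSolution Γ Ω a b
  conjTranspose_eq : Ωᴴ = Ω - I • Matrix.vecMulVec a (star a)

section DarbouxScalars

variable {ι : Type*} [Fintype ι] [DecidableEq ι]

/-- The value at one point of the Darboux transform `u' = u - η₂† Ω⁻¹ η₁`, with `q = u`, `a = η₁`
and `b = η₂`. -/
noncomputable def darbouxValue (q : ℂ) (Ω : Matrix ι ι ℂ) (a b : ι → ℂ) : ℂ :=
  q - sesqForm Ω⁻¹ b a

/-- The factor `1 - i η₁† Ω⁻¹ η₁`, which is the unimodular factor of `u'_x`. -/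
noncomputable def darbouxPhase (Ω : Matrix ι ι ℂ) (a : ι → ℂ) : ℂ :=
  1 - I * sesqForm Ω⁻¹ a a

/-- The factor of `u'_x` complementary to `darbouxPhase`, with `v = u_x`, `b = η₂`, `α = Γ⁻¹ η₁` and
`β = Γ⁻¹ η₂`. -/
noncomputable def darbouxAmplitude (v : ℂ) (Ω : Matrix ι ι ℂ) (b α β : ι → ℂ) : ℂ :=
  v * (1 - sesqForm Ω⁻¹ b β) + sesqForm Ω⁻¹ b α

theorem star_darbouxPhase (Ω : Matrix ι ι ℂ) (a : ι → ℂ) :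
    star (darbouxPhase Ω a) = 1 + I * star (sesqForm Ω⁻¹ a a) := by
  simp [darbouxPhase]

end DarbouxScalars

namespace IsDarbouxPotential

variable {ι : Type*} [Fintype ι] [DecidableEq ι] {Γ Ω : Matrix ι ι ℂ} {a b α β : ι → ℂ}

theorem sesqForm_inv_mulVec_add (h : IsDarbouxPotential Γ Ω a b) (x y : ι → ℂ) :
    sesqForm Ω⁻¹ x (Γ *ᵥ y) + sesqForm Ω⁻¹ (Γ *ᵥ x) y =
      I * sesqForm Ω⁻¹ x a * sesqForm Ω⁻¹ (Γ *ᵥ a) y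
        + sesqForm Ω⁻¹ x b * sesqForm Ω⁻¹ b y := by
  have hΩ : IsUnit Ω.det := (Matrix.isUnit_iff_isUnit_det Ω).1 h.isUnit
  have hinv : Ω⁻¹ * Γ + Γᴴ * Ω⁻¹ =
      I • (Ω⁻¹ * Matrix.vecMulVec a (star (Γ *ᵥ a)) * Ω⁻¹)
        + Ω⁻¹ * Matrix.vecMulVec b (star b) * Ω⁻¹ := by
    have := congrArg (fun M => Ω⁻¹ * M * Ω⁻¹) h.lyapunov
    simpa only [mul_add, add_mul, ← mul_assoc, Matrix.mul_nonsing_inv_cancel_right _ _ hΩ,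
      Matrix.nonsing_inv_mul _ hΩ, one_mul, mul_smul_comm, smul_mul_assoc, Matrix.star_mulVec,
      Matrix.mul_vecMulVec, Matrix.vecMulVec_mul] using this
  rw [← sesqForm_mul, ← sesqForm_conjTranspose_mul, ← LinearMap.add_apply, ← LinearMap.add_apply,
    ← map_add, hinv, map_add, map_smul]
  simp only [LinearMap.add_apply, LinearMap.smul_apply, sesqForm_mul_vecMulVec_mul, smul_eq_mul]
  rw [mul_assoc I]

theorem darbouxPhase_mul_star (h : IsDarbouxPotential Γ Ω a b) (y : ι → ℂ) :
    darbouxPhase Ω a * star (sesqForm Ω⁻¹ y a) = sesqForm Ω⁻¹ a y := by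
  have hinv : Ω⁻¹ - Ω⁻¹ᴴ = -(I • (Ω⁻¹ * Matrix.vecMulVec a (star a) * Ω⁻¹ᴴ)) := by
    rw [Matrix.conjTranspose_nonsing_inv,
      Matrix.inv_sub_inv (by simp only [Matrix.isUnit_conjTranspose]), h.conjTranspose_eq]
    simp only [sub_sub_cancel_left, mul_neg, neg_mul, mul_smul_comm, smul_mul_assoc]
  have := congrArg (fun W => sesqForm W a y) hinv
  simp only [map_sub, map_neg, map_smul, LinearMap.sub_apply, LinearMap.neg_apply,
    LinearMap.smul_apply, sesqForm_mul_vecMulVec_mul, ← star_sesqForm, smul_eq_mul] at this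
  rw [darbouxPhase]
  linear_combination -this

theorem darbouxPhase_mul_star_self (h : IsDarbouxPotential Γ Ω a b) :
    darbouxPhase Ω a * star (darbouxPhase Ω a) = 1 := by
  have hP : darbouxPhase Ω a = 1 - I * sesqForm Ω⁻¹ a a := rfl
  rw [star_darbouxPhase]
  linear_combination I * h.darbouxPhase_mul_star a + hP

theorem sesqForm_inv_mulVec_left (h : IsDarbouxPotential Γ Ω a b) (y : ι → ℂ) :
    sesqForm Ω⁻¹ (Γ *ᵥ a) y =
      star (sesqForm Ω⁻¹ b a) * sesqForm Ω⁻¹ b y - star (sesqForm Ω⁻¹ (Γ *ᵥ y) a) := by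
  refine mul_left_cancel₀ (left_ne_zero_of_mul_eq_one h.darbouxPhase_mul_star_self) ?_
  rw [mul_sub, ← mul_assoc, h.darbouxPhase_mul_star, h.darbouxPhase_mul_star, darbouxPhase]
  linear_combination h.sesqForm_inv_mulVec_add a y

theorem sesqForm_inv_mul_one_sub (h : IsDarbouxPotential Γ Ω a b) (hα : Γ *ᵥ α = a)
    (hβ : Γ *ᵥ β = b) :
    sesqForm Ω⁻¹ β a * (1 - sesqForm Ω⁻¹ b β) = -(darbouxPhase Ω a * sesqForm Ω⁻¹ b α) := by
  have hβα := h.sesqForm_inv_mulVec_add β α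
  have hββ := h.sesqForm_inv_mulVec_add β β
  rw [h.sesqForm_inv_mulVec_left, hα, hβ] at hβα
  rw [h.sesqForm_inv_mulVec_left, hβ] at hββ
  have key : sesqForm Ω⁻¹ β a * (1 - sesqForm Ω⁻¹ b β) * star (darbouxPhase Ω a) =
      -sesqForm Ω⁻¹ b α := by
    rw [star_darbouxPhase]
    linear_combination (1 - sesqForm Ω⁻¹ b β) * hβα + sesqForm Ω⁻¹ b α * hββ
  linear_combination darbouxPhase Ω a * key
    - sesqForm Ω⁻¹ β a * (1 - sesqForm Ω⁻¹ b β) * h.darbouxPhase_mul_star_self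

end IsDarbouxPotential

section Flows

variable {ι : Type*} [Fintype ι]

/-- The `t`-part of the linear system at the point `t` of a line `x = const`, with `q` the value of
`u`, `a = η₁` and `b = η₂`. -/
structure IsTimeFlowAt (Γ : Matrix ι ι ℂ) (q : ℂ) (a b : ℝ → ι → ℂ) (t : ℝ) : Prop where
  hasDerivAt_fst : HasDerivAt a
    ((I * (q * star q)) • a t - (1 / 2 : ℂ) • (Γ *ᵥ a t) + q • b t) t
  hasDerivAt_snd : HasDerivAt b
    ((1 / 2 : ℂ) • (Γ *ᵥ b t) - (I * (q * star q)) • b t + (I * star q) • (Γ *ᵥ a t)) t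

/-- The `x`-part of the linear system at the point `x` of a line `t = const`, with `v` the value of
`u_x`, `a = η₁`, `b = η₂`, `α = Γ⁻¹ η₁` and `β = Γ⁻¹ η₂`. -/
structure IsSpaceFlowAt (v : ℂ) (a b : ℝ → ι → ℂ) (α β : ι → ℂ) (x : ℝ) : Prop where
  hasDerivAt_fst : HasDerivAt a (v • β - (1 / 2 : ℂ) • α) x
  hasDerivAt_snd : HasDerivAt b ((1 / 2 : ℂ) • β - (I * star v) • a x) x

theorem IsTimeFlowAt.mulVec {Γ : Matrix ι ι ℂ} {q : ℂ} {a b : ℝ → ι → ℂ} {t : ℝ}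
    (h : IsTimeFlowAt Γ q a b t) {C : Matrix ι ι ℂ} (hC : Commute C Γ) :
    IsTimeFlowAt Γ q (fun s => C *ᵥ a s) (fun s => C *ᵥ b s) t where
  hasDerivAt_fst := (hasDerivAt_mulVec C h.hasDerivAt_fst).congr_deriv <| by
    simp only [Matrix.mulVec_add, Matrix.mulVec_sub, Matrix.mulVec_smul, Matrix.mulVec_mulVec,
      hC.eq]
  hasDerivAt_snd := (hasDerivAt_mulVec C h.hasDerivAt_snd).congr_deriv <| by
    simp only [Matrix.mulVec_add, Matrix.mulVec_sub, Matrix.mulVec_smul, Matrix.mulVec_mulVec,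
      hC.eq]

/-- The `t`-derivative of the Darboux potential, as a function of `q = u`, `a = η₁`, `b = η₂`. -/
noncomputable def potentialDerivT (Γ : Matrix ι ι ℂ) (q : ℂ) (a b : ι → ℂ) : Matrix ι ι ℂ :=
  (-I / 2) • Matrix.vecMulVec a (star (Γ *ᵥ a)) + (I * star q) • Matrix.vecMulVec a (star b)
    + (1 / 2 : ℂ) • Matrix.vecMulVec b (star b)

/-- The `x`-derivative of the Darboux potential, as a function of `v = u_x`, `a = η₁`,
`α = Γ⁻¹ η₁` and `β = Γ⁻¹ η₂`. -/
noncomputable def potentialDerivX (v : ℂ) (a α β : ι → ℂ) : Matrix ι ι ℂ :=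
  I • Matrix.vecMulVec (v • β - (1 / 2 : ℂ) • α) (star a)
    + (1 / 2 : ℂ) • Matrix.vecMulVec β (star β)

variable [DecidableEq ι] {Γ : Matrix ι ι ℂ} {Ω : ℝ → Matrix ι ι ℂ} {a b : ℝ → ι → ℂ} {t : ℝ}

theorem IsTimeFlowAt.hasDerivAt_potential {q : ℂ} (hab : IsTimeFlowAt Γ q a b t)
    (hΓ : Disjoint (spectrum ℂ Γ) (spectrum ℂ (-Γᴴ)))
    (h : ∀ᶠ s in 𝓝 t, IsLyapunovSolution Γ (Ω s) (a s) (b s)) :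
    HasDerivAt Ω (potentialDerivT Γ q (a t) (b t)) t := by
  refine hasDerivAt_of_lyapunov hΓ hab.hasDerivAt_fst hab.hasDerivAt_snd h ?_
  simp only [potentialDerivT, mul_add, add_mul, sub_mul, mul_smul_comm, smul_mul_assoc,
    Matrix.mul_vecMulVec, Matrix.vecMulVec_mul, star_sub, star_add, star_smul,
    Matrix.sub_vecMulVec, Matrix.smul_vecMulVec, Matrix.vecMulVec_sub, Matrix.add_vecMulVec,
    Matrix.vecMulVec_add, Matrix.vecMulVec_smul, Matrix.star_mulVec, star_mul',
    Complex.star_def, Complex.conj_conj, Complex.conj_I, map_div₀, map_one, map_ofNat]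
  match_scalars <;> ring

theorem IsSpaceFlowAt.hasDerivAt_potential {v : ℂ} {α β : ι → ℂ}
    (hab : IsSpaceFlowAt v a b α β t) (hΓ : Disjoint (spectrum ℂ Γ) (spectrum ℂ (-Γᴴ)))
    (hα : Γ *ᵥ α = a t) (hβ : Γ *ᵥ β = b t)
    (h : ∀ᶠ s in 𝓝 t, IsLyapunovSolution Γ (Ω s) (a s) (b s)) :
    HasDerivAt Ω (potentialDerivX v (a t) α β) t := by
  refine hasDerivAt_of_lyapunov hΓ hab.hasDerivAt_fst hab.hasDerivAt_snd h ?_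
  have hα' : star α ᵥ* Γᴴ = star (a t) := by rw [← hα, Matrix.star_mulVec]
  have hβ' : star β ᵥ* Γᴴ = star (b t) := by rw [← hβ, Matrix.star_mulVec]
  simp only [potentialDerivX, mul_add, mul_sub, add_mul, sub_mul, mul_smul_comm, smul_mul_assoc,
    Matrix.mul_vecMulVec, Matrix.vecMulVec_mul, star_sub, star_smul, Matrix.sub_vecMulVec,
    Matrix.smul_vecMulVec, Matrix.vecMulVec_sub, Matrix.vecMulVec_smul, hα, hβ, hα', hβ',
    star_mul', Complex.star_def, Complex.conj_conj, Complex.conj_I, map_div₀, map_one, map_ofNat]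
  match_scalars <;> ring

end Flows

section TimeEvolution

variable {ι : Type*} [Fintype ι] [DecidableEq ι] {Γ : Matrix ι ι ℂ} {Ω : ℝ → Matrix ι ι ℂ}
  {a b α β : ℝ → ι → ℂ} {q : ℂ} {v : ℝ → ℂ} {t : ℝ}

theorem hasDerivAt_sesqForm_inv_of_potentialDerivT {x y : ℝ → ι → ℂ} {x' y' : ι → ℂ}
    (hu : IsUnit (Ω t))
    (hΩ : HasDerivAt Ω (potentialDerivT Γ q (a t) (b t)) t) (hx : HasDerivAt x x' t)
    (hy : HasDerivAt y y' t) :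
    HasDerivAt (fun s => sesqForm (Ω s)⁻¹ (x s) (y s))
      (sesqForm (Ω t)⁻¹ x' (y t) + sesqForm (Ω t)⁻¹ (x t) y'
        + I / 2 * sesqForm (Ω t)⁻¹ (x t) (a t) * sesqForm (Ω t)⁻¹ (Γ *ᵥ a t) (y t)
        - I * star q * sesqForm (Ω t)⁻¹ (x t) (a t) * sesqForm (Ω t)⁻¹ (b t) (y t)
        - 1 / 2 * sesqForm (Ω t)⁻¹ (x t) (b t) * sesqForm (Ω t)⁻¹ (b t) (y t)) t := by
  refine (hasDerivAt_sesqForm_inv hΩ hu hx hy).congr_deriv ?_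
  simp only [potentialDerivT, mul_add, add_mul, mul_smul_comm, smul_mul_assoc, map_add, map_smul,
    LinearMap.add_apply, LinearMap.smul_apply, sesqForm_mul_vecMulVec_mul, smul_eq_mul]
  ring

theorem hasDerivAt_darbouxPhase (h : IsDarbouxPotential Γ (Ω t) (a t) (b t))
    (hΩ : HasDerivAt Ω (potentialDerivT Γ q (a t) (b t)) t) (hab : IsTimeFlowAt Γ q a b t) :
    HasDerivAt (fun s => darbouxPhase (Ω s) (a s))
      (I * (darbouxValue q (Ω t) (a t) (b t) * star (darbouxValue q (Ω t) (a t) (b t))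
        - q * star q) * darbouxPhase (Ω t) (a t)) t := by
  refine (((hasDerivAt_sesqForm_inv_of_potentialDerivT h.isUnit hΩ hab.hasDerivAt_fst
    hab.hasDerivAt_fst).const_mul I).const_sub 1).congr_deriv ?_
  have haa := h.sesqForm_inv_mulVec_add (a t) (a t)
  have hfc := h.darbouxPhase_mul_star (b t)
  simp only [darbouxValue, darbouxPhase, map_add, map_sub, map_smulₛₗ, LinearMap.add_apply,
    LinearMap.sub_apply, LinearMap.smul_apply, smul_eq_mul, star_sub, map_mul, map_div₀, map_one,
    map_ofNat, RingHom.id_apply, Complex.star_def, Complex.conj_conj, Complex.conj_I] at hfc ⊢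
  linear_combination (I / 2) * haa + I * (q - sesqForm (Ω t)⁻¹ (b t) (a t)) * hfc

theorem hasDerivAt_one_sub_sesqForm_inv (h : IsDarbouxPotential Γ (Ω t) (a t) (b t))
    (hα : Γ *ᵥ α t = a t) (hβ : Γ *ᵥ β t = b t)
    (hΩ : HasDerivAt Ω (potentialDerivT Γ q (a t) (b t)) t) (hab : IsTimeFlowAt Γ q a b t)
    (hαβ : IsTimeFlowAt Γ q α β t) :
    HasDerivAt (fun s => 1 - sesqForm (Ω s)⁻¹ (b s) (β s))
      (I * (darbouxValue q (Ω t) (a t) (b t) * star (darbouxValue q (Ω t) (a t) (b t))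
        - q * star q) * (1 - sesqForm (Ω t)⁻¹ (b t) (β t))) t := by
  refine ((hasDerivAt_sesqForm_inv_of_potentialDerivT h.isUnit hΩ hab.hasDerivAt_snd
    hαβ.hasDerivAt_snd).const_sub 1).congr_deriv ?_
  have hbβ := h.sesqForm_inv_mulVec_add (b t) (β t)
  have haβ := h.sesqForm_inv_mulVec_left (β t)
  rw [hβ] at hbβ haβ
  rw [hα, hβ]
  simp only [darbouxValue, map_add, map_sub, map_smulₛₗ, LinearMap.add_apply,
    LinearMap.sub_apply, LinearMap.smul_apply, smul_eq_mul, star_sub, map_mul, map_div₀, map_one,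
    map_ofNat, RingHom.id_apply, Complex.star_def, Complex.conj_conj, Complex.conj_I] at haβ ⊢
  linear_combination (-1 / 2) * hbβ + (I * q - I * sesqForm (Ω t)⁻¹ (b t) (a t)) * haβ

theorem hasDerivAt_sesqForm_inv_preimage (h : IsDarbouxPotential Γ (Ω t) (a t) (b t))
    (hα : Γ *ᵥ α t = a t) (hΩ : HasDerivAt Ω (potentialDerivT Γ q (a t) (b t)) t)
    (hab : IsTimeFlowAt Γ q a b t) (hαβ : IsTimeFlowAt Γ q α β t) :
    HasDerivAt (fun s => sesqForm (Ω s)⁻¹ (b s) (α s))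
      (star (darbouxPhase (Ω t) (a t)) * darbouxValue q (Ω t) (a t) (b t)
        - q * (1 - sesqForm (Ω t)⁻¹ (b t) (β t))
        + I * (q * star q + darbouxValue q (Ω t) (a t) (b t)
          * star (darbouxValue q (Ω t) (a t) (b t))) * sesqForm (Ω t)⁻¹ (b t) (α t)) t := by
  refine (hasDerivAt_sesqForm_inv_of_potentialDerivT h.isUnit hΩ hab.hasDerivAt_snd
    hαβ.hasDerivAt_fst).congr_deriv ?_
  have hbα := h.sesqForm_inv_mulVec_add (b t) (α t)
  have haα := h.sesqForm_inv_mulVec_left (α t)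
  rw [hα] at hbα haα
  rw [hα, star_darbouxPhase]
  simp only [darbouxValue, map_add, map_sub, map_smulₛₗ, LinearMap.add_apply,
    LinearMap.sub_apply, LinearMap.smul_apply, smul_eq_mul, star_sub, map_mul, map_div₀, map_one,
    map_ofNat, RingHom.id_apply, Complex.star_def, Complex.conj_conj, Complex.conj_I] at haα ⊢
  linear_combination (1 / 2) * hbα - I * (q - sesqForm (Ω t)⁻¹ (b t) (a t)) * haα

theorem hasDerivAt_darbouxAmplitude (h : IsDarbouxPotential Γ (Ω t) (a t) (b t))
    (hα : Γ *ᵥ α t = a t) (hβ : Γ *ᵥ β t = b t)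
    (hΩ : HasDerivAt Ω (potentialDerivT Γ q (a t) (b t)) t) (hab : IsTimeFlowAt Γ q a b t)
    (hαβ : IsTimeFlowAt Γ q α β t) (hv : HasDerivAt v (q + 2 * I * (q * star q) * v t) t) :
    HasDerivAt (fun s => darbouxAmplitude (v s) (Ω s) (b s) (α s) (β s))
      (star (darbouxPhase (Ω t) (a t)) * darbouxValue q (Ω t) (a t) (b t)
        + I * (q * star q + darbouxValue q (Ω t) (a t) (b t)
          * star (darbouxValue q (Ω t) (a t) (b t)))
          * darbouxAmplitude (v t) (Ω t) (b t) (α t) (β t)) t := by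
  refine ((hv.mul (hasDerivAt_one_sub_sesqForm_inv h hα hβ hΩ hab hαβ)).add
    (hasDerivAt_sesqForm_inv_preimage h hα hΩ hab hαβ)).congr_deriv ?_
  rw [darbouxAmplitude]
  ring

theorem hasDerivAt_darbouxPhase_mul_darbouxAmplitude
    (h : IsDarbouxPotential Γ (Ω t) (a t) (b t)) (hα : Γ *ᵥ α t = a t) (hβ : Γ *ᵥ β t = b t)
    (hΩ : HasDerivAt Ω (potentialDerivT Γ q (a t) (b t)) t) (hab : IsTimeFlowAt Γ q a b t)
    (hαβ : IsTimeFlowAt Γ q α β t) (hv : HasDerivAt v (q + 2 * I * (q * star q) * v t) t) :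
    HasDerivAt (fun s => darbouxPhase (Ω s) (a s) *
        darbouxAmplitude (v s) (Ω s) (b s) (α s) (β s))
      (darbouxValue q (Ω t) (a t) (b t)
        + 2 * I * (darbouxValue q (Ω t) (a t) (b t) * star (darbouxValue q (Ω t) (a t) (b t)))
          * (darbouxPhase (Ω t) (a t) *
            darbouxAmplitude (v t) (Ω t) (b t) (α t) (β t))) t := by
  refine ((hasDerivAt_darbouxPhase h hΩ hab).mul
    (hasDerivAt_darbouxAmplitude h hα hβ hΩ hab hαβ hv)).congr_deriv ?_
  linear_combination darbouxValue q (Ω t) (a t) (b t) * h.darbouxPhase_mul_star_self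

end TimeEvolution

theorem hasDerivAt_darbouxValue {ι : Type*} [Fintype ι] [DecidableEq ι] {Γ : Matrix ι ι ℂ}
    {Ω : ℝ → Matrix ι ι ℂ} {a b : ℝ → ι → ℂ} {α β : ι → ℂ} {q : ℝ → ℂ} {v : ℂ} {x : ℝ}
    (h : IsDarbouxPotential Γ (Ω x) (a x) (b x)) (hα : Γ *ᵥ α = a x) (hβ : Γ *ᵥ β = b x)
    (hΩ : HasDerivAt Ω (potentialDerivX v (a x) α β) x) (hab : IsSpaceFlowAt v a b α β x)
    (hq : HasDerivAt q v x) :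
    HasDerivAt (fun s => darbouxValue (q s) (Ω s) (a s) (b s))
      (darbouxPhase (Ω x) (a x) * darbouxAmplitude v (Ω x) (b x) α β) x := by
  refine (hq.sub (hasDerivAt_sesqForm_inv hΩ h.isUnit hab.hasDerivAt_snd
    hab.hasDerivAt_fst)).congr_deriv ?_
  simp only [potentialDerivX, mul_add, add_mul, mul_smul_comm, smul_mul_assoc, map_add, map_sub,
    map_smulₛₗ, LinearMap.add_apply, LinearMap.sub_apply, LinearMap.smul_apply,
    sesqForm_mul_vecMulVec_mul, smul_eq_mul, map_mul, map_div₀, map_one, map_ofNat,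
    RingHom.id_apply, Complex.star_def, Complex.conj_conj, Complex.conj_I]
  have hp := h.sesqForm_inv_mul_one_sub hα hβ
  rw [darbouxPhase] at hp
  rw [darbouxPhase, darbouxAmplitude]
  linear_combination (-1 / 2) * hp

section PartialDerivatives

variable {E : Type*} [NormedAddCommGroup E] [NormedSpace ℝ E] {f : ℝ × ℝ → E} {p : ℝ × ℝ}
  {D : Set (ℝ × ℝ)}

theorem eventually_mk_left_mem (hD : IsOpen D) (hp : p ∈ D) : ∀ᶠ s in 𝓝 p.1, (s, p.2) ∈ D :=
  (Continuous.prodMk_left p.2).continuousAt.eventually (hD.mem_nhds hp)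

theorem eventually_mk_right_mem (hD : IsOpen D) (hp : p ∈ D) : ∀ᶠ s in 𝓝 p.2, (p.1, s) ∈ D :=
  (Continuous.prodMk_right p.1).continuousAt.eventually (hD.mem_nhds hp)

theorem hasDerivAt_partialX (hf : DifferentiableAt ℝ f p) :
    HasDerivAt (fun s => f (s, p.2)) (partialX f p) p.1 :=
  (DifferentiableAt.comp (f := fun s : ℝ => (s, p.2)) p.1 hf (by fun_prop)).hasDerivAt

theorem hasDerivAt_partialT (hf : DifferentiableAt ℝ f p) :
    HasDerivAt (fun s => f (p.1, s)) (partialT f p) p.2 :=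
  (DifferentiableAt.comp (f := fun s : ℝ => (p.1, s)) p.2 hf (by fun_prop)).hasDerivAt

theorem partialX_eq_fderiv (hf : DifferentiableAt ℝ f p) : partialX f p = fderiv ℝ f p (1, 0) :=
  (hf.hasFDerivAt.comp_hasDerivAt (f := fun s : ℝ => (s, p.2)) p.1
    ((hasDerivAt_id p.1).prodMk (hasDerivAt_const p.1 p.2))).deriv

theorem differentiableAt_of_contDiffOn {k : WithTop ℕ∞} (hD : IsOpen D) (hf : ContDiffOn ℝ k f D)
    (hk : k ≠ 0) (hp : p ∈ D) : DifferentiableAt ℝ f p :=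
  (hf.differentiableOn hk).differentiableAt (hD.mem_nhds hp)

theorem differentiableAt_partialX (hD : IsOpen D) (hf : ContDiffOn ℝ 2 f D) (hp : p ∈ D) :
    DifferentiableAt ℝ (partialX f) p := by
  have hf' : DifferentiableAt ℝ (fun x => fderiv ℝ f x (1, 0)) p :=
    (((hf.fderiv_of_isOpen hD (m := 1) (by norm_num)).differentiableOn
      one_ne_zero).differentiableAt (hD.mem_nhds hp)).clm_apply (differentiableAt_const _)
  refine hf'.congr_of_eventuallyEq ?_
  filter_upwards [hD.mem_nhds hp] with x hx
  exact partialX_eq_fderiv ((hf.differentiableOn two_ne_zero).differentiableAt (hD.mem_nhds hx))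

end PartialDerivatives

theorem mulVec_inv_mulVec {ι R : Type*} [Fintype ι] [DecidableEq ι] [CommRing R]
    {A : Matrix ι ι R} (hA : IsUnit A) (y : ι → R) : A *ᵥ (A⁻¹ *ᵥ y) = y := by
  rw [Matrix.mulVec_mulVec, Matrix.mul_nonsing_inv _ ((Matrix.isUnit_iff_isUnit_det A).1 hA),
    Matrix.one_mulVec]

section DarbouxTransform

variable {n : ℕ} {Γ : Matrix (Fin n) (Fin n) ℂ} {D U : Set (ℝ × ℝ)} {u : ℝ × ℝ → ℂ}
  {η₁ η₂ : ℝ × ℝ → Fin n → ℂ} {Ω : ℝ × ℝ → Matrix (Fin n) (Fin n) ℂ} {p : ℝ × ℝ}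

theorem IsFokasLenellsSolutionOn.hasDerivAt_partialX_slice (hD : IsOpen D)
    (hu : IsFokasLenellsSolutionOn D u) (hp : p ∈ D) :
    HasDerivAt (fun s => partialX u (p.1, s))
      (u p + 2 * I * (u p * star (u p)) * partialX u p) p.2 := by
  refine (hasDerivAt_partialT (differentiableAt_partialX hD
    (hu.1.of_le (by norm_cast)) hp)).congr_deriv ?_
  have := hu.2 p hp
  rw [← Complex.mul_conj'] at this
  simp only [Complex.star_def]
  linear_combination this

theorem IsLinearSystemSolutionOn.isTimeFlowAt (hD : IsOpen D)
    (hη : IsLinearSystemSolutionOn D Γ u η₁ η₂) (hp : p ∈ D) :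
    IsTimeFlowAt Γ (u p) (fun s => η₁ (p.1, s)) (fun s => η₂ (p.1, s)) p.2 := by
  have h₁ := hη.eq_t₁ p hp
  have h₂ := hη.eq_t₂ p hp
  simp only [Matrix.sub_mulVec, Matrix.smul_mulVec, Matrix.one_mulVec, ← Complex.mul_conj',
    ← Complex.star_def] at h₁ h₂
  constructor
  · refine (hasDerivAt_partialT (differentiableAt_of_contDiffOn hD hη.smooth₁
      (by simp) hp)).congr_deriv (sub_eq_zero.1 (Eq.trans ?_ h₁))
    module
  · refine (hasDerivAt_partialT (differentiableAt_of_contDiffOn hD hη.smooth₂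
      (by simp) hp)).congr_deriv (sub_eq_zero.1 (Eq.trans ?_ h₂))
    module

theorem IsLinearSystemSolutionOn.isSpaceFlowAt (hD : IsOpen D) (hΓ : IsUnit Γ)
    (hη : IsLinearSystemSolutionOn D Γ u η₁ η₂) (hp : p ∈ D) :
    IsSpaceFlowAt (partialX u p) (fun s => η₁ (s, p.2)) (fun s => η₂ (s, p.2))
      (Γ⁻¹ *ᵥ η₁ p) (Γ⁻¹ *ᵥ η₂ p) p.1 := by
  have h₁ := congrArg (Γ⁻¹ *ᵥ ·) (hη.eq_x₁ p hp)
  have h₂ := congrArg (Γ⁻¹ *ᵥ ·) (hη.eq_x₂ p hp)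
  simp only [Matrix.mulVec_add, Matrix.mulVec_sub, Matrix.mulVec_smul, Matrix.mulVec_mulVec,
    Matrix.nonsing_inv_mul _ ((Matrix.isUnit_iff_isUnit_det Γ).1 hΓ), Matrix.one_mulVec,
    Matrix.mulVec_zero] at h₁ h₂
  constructor
  · refine (hasDerivAt_partialX (differentiableAt_of_contDiffOn hD hη.smooth₁
      (by simp) hp)).congr_deriv (sub_eq_zero.1 (Eq.trans ?_ h₁))
    module
  · refine (hasDerivAt_partialX (differentiableAt_of_contDiffOn hD hη.smooth₂
      (by simp) hp)).congr_deriv (sub_eq_zero.1 (Eq.trans ?_ h₂))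
    module

theorem darbouxTransform_eq_darbouxValue :
    darbouxTransform u η₁ η₂ Ω = fun p => darbouxValue (u p) (Ω p) (η₁ p) (η₂ p) := by
  ext p
  rw [darbouxTransform, darbouxValue, sesqForm_apply]

theorem contDiffOn_darbouxTransform {k : WithTop ℕ∞}
    (hspec : Disjoint (spectrum ℂ Γ) (spectrum ℂ (-Γᴴ))) (hu : ContDiffOn ℝ k u U)
    (hη₁ : ContDiffOn ℝ k η₁ U) (hη₂ : ContDiffOn ℝ k η₂ U)
    (hΩ : ∀ p ∈ U, IsLyapunovSolution Γ (Ω p) (η₁ p) (η₂ p)) (hinv : ∀ p ∈ U, IsUnit (Ω p)) :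
    ContDiffOn ℝ k (darbouxTransform u η₁ η₂ Ω) U := by
  rw [darbouxTransform_eq_darbouxValue]
  exact hu.sub <| contDiffOn_sesqForm
    (contDiffOn_matrix_inv (contDiffOn_of_lyapunov hspec hη₁ hη₂ hΩ) hinv) hη₂ hη₁

theorem partialX_darbouxTransform (hD : IsOpen D) (hΓ : IsUnit Γ)
    (hspec : Disjoint (spectrum ℂ Γ) (spectrum ℂ (-Γᴴ))) (hu : DifferentiableAt ℝ u p)
    (hη : IsLinearSystemSolutionOn D Γ u η₁ η₂)
    (hΩ : ∀ p ∈ D, IsLyapunovSolution Γ (Ω p) (η₁ p) (η₂ p))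
    (hp : p ∈ D) (h : IsDarbouxPotential Γ (Ω p) (η₁ p) (η₂ p)) :
    partialX (darbouxTransform u η₁ η₂ Ω) p = darbouxPhase (Ω p) (η₁ p) *
      darbouxAmplitude (partialX u p) (Ω p) (η₂ p) (Γ⁻¹ *ᵥ η₁ p) (Γ⁻¹ *ᵥ η₂ p) := by
  have hflow := hη.isSpaceFlowAt hD hΓ hp
  have hα := mulVec_inv_mulVec hΓ (η₁ p)
  have hβ := mulVec_inv_mulVec hΓ (η₂ p)
  have hΩ' := hflow.hasDerivAt_potential hspec hα hβ
    ((eventually_mk_left_mem hD hp).mono fun _ => hΩ _)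
  have hderiv := hasDerivAt_darbouxValue (q := fun s => u (s, p.2)) (Ω := fun s => Ω (s, p.2))
    (a := fun s => η₁ (s, p.2)) (b := fun s => η₂ (s, p.2)) h hα hβ hΩ' hflow
    (hasDerivAt_partialX hu)
  rw [darbouxTransform_eq_darbouxValue]
  exact hderiv.deriv

theorem partialT_partialX_darbouxTransform (hD : IsOpen D) (hΓ : IsUnit Γ)
    (hspec : Disjoint (spectrum ℂ Γ) (spectrum ℂ (-Γᴴ))) (hu : IsFokasLenellsSolutionOn D u)
    (hη : IsLinearSystemSolutionOn D Γ u η₁ η₂)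
    (hΩ : ∀ p ∈ D, IsLyapunovSolution Γ (Ω p) (η₁ p) (η₂ p))
    (hU : IsOpen U) (hUD : U ⊆ D) (h : ∀ p ∈ U, IsDarbouxPotential Γ (Ω p) (η₁ p) (η₂ p))
    (hp : p ∈ U) :
    partialT (partialX (darbouxTransform u η₁ η₂ Ω)) p = darbouxTransform u η₁ η₂ Ω p
      + 2 * I * (darbouxTransform u η₁ η₂ Ω p * star (darbouxTransform u η₁ η₂ Ω p))
        * partialX (darbouxTransform u η₁ η₂ Ω) p := by
  have hX : ∀ r ∈ U, partialX (darbouxTransform u η₁ η₂ Ω) r = darbouxPhase (Ω r) (η₁ r) *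
      darbouxAmplitude (partialX u r) (Ω r) (η₂ r) (Γ⁻¹ *ᵥ η₁ r) (Γ⁻¹ *ᵥ η₂ r) := fun r hr =>
    partialX_darbouxTransform hD hΓ hspec (differentiableAt_of_contDiffOn hD hu.1 (by simp)
      (hUD hr)) hη hΩ (hUD hr) (h r hr)
  have hcomm : Commute Γ⁻¹ Γ := by
    have hdet := (Matrix.isUnit_iff_isUnit_det Γ).1 hΓ
    exact (Matrix.nonsing_inv_mul _ hdet).trans (Matrix.mul_nonsing_inv _ hdet).symm
  have hflow := hη.isTimeFlowAt hD (hUD hp)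
  have hΩ' := hflow.hasDerivAt_potential hspec
    ((eventually_mk_right_mem hD (hUD hp)).mono fun _ => hΩ _)
  have hT := hasDerivAt_darbouxPhase_mul_darbouxAmplitude (Ω := fun s => Ω (p.1, s))
    (a := fun s => η₁ (p.1, s)) (b := fun s => η₂ (p.1, s))
    (α := fun s => Γ⁻¹ *ᵥ η₁ (p.1, s)) (β := fun s => Γ⁻¹ *ᵥ η₂ (p.1, s))
    (v := fun s => partialX u (p.1, s)) (h p hp) (mulVec_inv_mulVec hΓ _)
    (mulVec_inv_mulVec hΓ _) hΩ' hflow (hflow.mulVec hcomm)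
    (hu.hasDerivAt_partialX_slice hD (hUD hp))
  have hT' := hT.congr_of_eventuallyEq
    ((eventually_mk_right_mem hU hp).mono fun s hs => hX (p.1, s) hs)
  rw [hX p hp]
  rw [darbouxTransform_eq_darbouxValue] at hT' ⊢
  exact hT'.deriv

end DarbouxTransform

theorem theorem4 {n : ℕ} (Γ : Matrix (Fin n) (Fin n) ℂ) (hΓ : IsUnit Γ)
    (hspec : ¬ ∃ μ : ℂ, Module.End.HasEigenvalue (Matrix.toLin' Γ) μ ∧
      Module.End.HasEigenvalue (Matrix.toLin' (-Γᴴ)) μ)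
    (D : Set (ℝ × ℝ)) (hD : IsOpen D)
    (u : ℝ × ℝ → ℂ) (hu : IsFokasLenellsSolutionOn D u)
    (η₁ η₂ : ℝ × ℝ → Fin n → ℂ) (hη : IsLinearSystemSolutionOn D Γ u η₁ η₂)
    (Ω : ℝ × ℝ → Matrix (Fin n) (Fin n) ℂ)
    (hΩ : ∀ p ∈ D, Γ * Ω p + Ω p * Γᴴ =
      Complex.I • (Matrix.vecMulVec (η₁ p) (star (η₁ p)) * Γᴴ)
        + Matrix.vecMulVec (η₂ p) (star (η₂ p)))
    (U : Set (ℝ × ℝ)) (hU : IsOpen U) (hUD : U ⊆ D) (hinv : ∀ p ∈ U, IsUnit (Ω p)) :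
    IsFokasLenellsSolutionOn U (darbouxTransform u η₁ η₂ Ω) := by
  have hdisj : Disjoint (spectrum ℂ Γ) (spectrum ℂ (-Γᴴ)) := by
    refine Set.disjoint_left.2 fun μ h₁ h₂ => hspec ⟨μ, ?_, ?_⟩ <;>
      rwa [Module.End.hasEigenvalue_iff_mem_spectrum, Matrix.spectrum_toLin']
  have hpot : ∀ p ∈ U, IsDarbouxPotential Γ (Ω p) (η₁ p) (η₂ p) := fun p hp =>
    ⟨hinv p hp, hΩ p (hUD hp), conjTranspose_eq_of_lyapunov hdisj (hΩ p (hUD hp))⟩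
  refine ⟨?_, fun p hp => ?_⟩
  · exact contDiffOn_darbouxTransform hdisj (hu.1.mono hUD) (hη.smooth₁.mono hUD)
      (hη.smooth₂.mono hUD) (fun p hp => hΩ p (hUD hp)) hinv
  · rw [partialT_partialX_darbouxTransform hD hΓ hdisj hu hη hΩ hU hUD hpot hp,
      ← Complex.mul_conj', Complex.star_def]
    ring
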